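/- A scheme (association scheme) on a finite set $X$ is a partition $S$ of $X\times X$ into nonempty relations that contains the diagonal $1_X$, contains $s^*=\{(x,y):(y,x)\in s\}$ whenever it contains $s$, and such that for all $p,q,r\in S$ there is an integer $a_{pq}^r\ge 0$ with $|\{y:(x,y)\in p,\ (y,z)\in q\}|=a_{pq}^r$ for every $(x,z)\in r$. The complex product of $P,Q\subseteq S$ is $PQ=\{r\in S: a_{pq}^r>0 \text{ for some } p\in P,\ q\in Q\}$. A nonempty $T\subseteq S$ is closed if $TT=T$, and a closed $T$ is strongly normal if $p^*Tp=T$ for all $p\in S$. The thin residue $O^{\vartheta}(S)$ is the intersection of all strongly normal closed subsets of $S$. For closed $T$, put $xT=\{y:(x,y)\in t\text{ for some }t\in T\}$ and $X/T=\{xT:x\in X\}$; the quotient scheme $S/\!/T$ is the scheme on $X/T$ whose elements are the relations $s^T=\{(xT,yT):(x',y')\in s\text{ for some }x'\in xT,\ y'\in yT\}$, $s\in S$. The singleton subsets of $S/\!/O^{\vartheta}(S)$ form a finite group $\mathrm{Quo}(S)$ under the complex product. A morphism $\phi$ from a scheme $S$ on $X$ to a scheme $T$ on $Y$ consists of maps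 $X\to Y$ and $S\to T$, both written $\phi$, with $(\phi(x_1),\phi(x_2))\in\phi(s)$ whenever $(x_1,x_2)\in s\in S$. It is admissible if whenever $x\in X$, $y\in Y$, $s\in S$ and $(\phi(x),y)\in\phi(s)$, there is $x'\in X$ with $\phi(x')=y$ and $(x,x')\in s$. Let $\mathcal S_{\mathrm a}$ be the category whose objects are the schemes on finite sets and whose morphisms are the classes of admissible morphisms under the relation $\phi\sim\phi'$ iff $\phi(s)=\phi'(s)$ for all $s\in S$. Let $\mathcal G$ be the category of finite groups. Let $\mathrm{Quo}:\mathcal S_{\mathrm a}\to\mathcal G$ be the functor with the above values on objects and $\mathrm{Quo}(\phi)(\{s^{O^{\vartheta}(S)}\})=\{\phi(s)^{O^{\vartheta}(T)}\}$ on morphisms. Let $S_{\mathrm a}:\mathcal G\to\mathcal S_{\mathrm a}$ be the functor that sends a finite group $G$ to the scheme on $G$ with elements $\tilde g=\{(g_1,g_2):g_2=g_1g\}$, $g\in G$, and a homomorphism $f:G\to H$ to the class of the morphism $g\mapsto f(g)$, $\tilde g\mapsto \widetilde{f(g)}$. **Proposition.** There is an adjunction between $\mathcal G$ and $\mathcal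 S_{\mathrm a}$ for which $\mathrm{Quo}:\mathcal S_{\mathrm a}\to\mathcal G$ is the left adjoint functor and $S_{\mathrm a}:\mathcal G\to\mathcal S_{\mathrm a}$ is the right adjoint functor. -/

import Mathlib

open CategoryTheory

universe u

/-- An association scheme on a finite set `X`: a partition of `X × X` into nonempty relations,
containing the diagonal, closed under transposition, and having structure constants. -/
structure AssocScheme (X : Type u) [Finite X] where
  /-- the elements of the scheme -/
  rels : Set (Set (X × X))
  isPartition : Setoid.IsPartition rels
  diag_mem : {w : X × X | w.1 = w.2} ∈ rels
  transpose_mem : ∀ s ∈ rels, {w : X × X | (w.2, w.1) ∈ s} ∈ rels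
  regular : ∀ p ∈ rels, ∀ q ∈ rels, ∀ r ∈ rels, ∃ a : ℕ, ∀ x z : X, (x, z) ∈ r →
    {y : X | (x, y) ∈ p ∧ (y, z) ∈ q}.ncard = a

namespace AssocScheme

section Basic

variable {X : Type u} [Finite X] (S : AssocScheme X)

/-- The type of elements (relations) of the scheme `S`. -/
abbrev Elem : Type u := ↥S.rels

/-- The element `1_X`. -/
def one : S.Elem := ⟨_, S.diag_mem⟩

/-- The element `s^*`. -/
def inv (s : S.Elem) : S.Elem := ⟨_, S.transpose_mem s.1 s.2⟩

/-- The structure constant `a_{pq}^r`. -/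
noncomputable def structConst (p q r : S.Elem) : ℕ :=
  (S.regular p.1 p.2 q.1 q.2 r.1 r.2).choose

/-- The complex product of two sets of elements. -/
def cmul (P Q : Set S.Elem) : Set S.Elem :=
  {r | ∃ p ∈ P, ∃ q ∈ Q, 0 < S.structConst p q r}

/-- `T` is a closed subset of `S`. -/
def IsClosedSubset (T : Set S.Elem) : Prop := T.Nonempty ∧ S.cmul T T = T

/-- `T` is a strongly normal closed subset of `S`. -/
def IsStronglyNormal (T : Set S.Elem) : Prop :=
  S.IsClosedSubset T ∧ ∀ p : S.Elem, S.cmul (S.cmul {S.inv p} T) {p} = T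

/-- The thin residue of `S`: the intersection of all strongly normal closed subsets. -/
def thinResidue : Set S.Elem := ⋂₀ {T | S.IsStronglyNormal T}

/-- All elements `s` of `S` are thin, that is `s s^* = {1}`. -/
def IsThin : Prop := ∀ s : S.Elem, S.cmul {s} {S.inv s} = {S.one}

/-- The geometric coset `xT`. -/
def coset (T : Set S.Elem) (x : X) : Set X := {y | ∃ t ∈ T, (x, y) ∈ t.1}

/-- The set `X/T` of geometric cosets of `T`. -/
abbrev Cosets (T : Set S.Elem) : Type u := ↥(Set.range (S.coset T))

/-- The coset `xT` as a point of `X/T`. -/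
def toCoset (T : Set S.Elem) (x : X) : S.Cosets T := ⟨S.coset T x, x, rfl⟩

/-- The relation `s^T` on `X/T`. -/
def quotRel (T : Set S.Elem) (s : S.Elem) : Set (S.Cosets T × S.Cosets T) :=
  {w | ∃ x' ∈ w.1.1, ∃ y' ∈ w.2.1, (x', y') ∈ s.1}

/-! Helper facts: computing in a scheme through the element containing a given pair. -/

/-- The unique element of `S` containing `(x, y)`. -/
noncomputable def rel (x y : X) : S.Elem :=
  ⟨(S.isPartition.2 (x, y)).choose, (S.isPartition.2 (x, y)).choose_spec.1.1⟩

theorem mem_rel (x y : X) : (x, y) ∈ (S.rel x y).1 :=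
  (S.isPartition.2 (x, y)).choose_spec.1.2

theorem rel_eq_iff {x y : X} {s : S.Elem} : S.rel x y = s ↔ (x, y) ∈ s.1 := by
  constructor
  · rintro rfl
    exact S.mem_rel x y
  · intro h
    exact Subtype.ext ((S.isPartition.2 (x, y)).unique ⟨(S.rel x y).2, S.mem_rel x y⟩ ⟨s.2, h⟩)

theorem exists_rel (s : S.Elem) : ∃ x y, S.rel x y = s := by
  have h : s.1.Nonempty := Set.nonempty_iff_ne_empty.2 fun h => S.isPartition.1 (h ▸ s.2)
  obtain ⟨⟨x, y⟩, h⟩ := h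
  exact ⟨x, y, S.rel_eq_iff.2 h⟩

theorem rel_eq_one {x y : X} : S.rel x y = S.one ↔ x = y := by
  rw [rel_eq_iff]; rfl

theorem rel_self (x : X) : S.rel x x = S.one := S.rel_eq_one.2 rfl

theorem rel_swap (x y : X) : S.rel y x = S.inv (S.rel x y) :=
  S.rel_eq_iff.2 (S.mem_rel x y)

theorem inv_inv (s : S.Elem) : S.inv (S.inv s) = s := rfl

theorem structConst_rel (p q : S.Elem) (x z : X) :
    S.structConst p q (S.rel x z) = {y : X | S.rel x y = p ∧ S.rel y z = q}.ncard := by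
  have h := (S.regular p.1 p.2 q.1 q.2 _ (S.rel x z).2).choose_spec x z (S.mem_rel x z)
  simp only [rel_eq_iff]
  exact h.symm

theorem rel_mem_cmul {P Q : Set S.Elem} {x z : X} :
    S.rel x z ∈ S.cmul P Q ↔ ∃ y, S.rel x y ∈ P ∧ S.rel y z ∈ Q := by
  simp only [cmul, Set.mem_ofPred_eq, structConst_rel, Set.ncard_pos (Set.toFinite _)]
  constructor
  · rintro ⟨p, hp, q, hq, y, rfl, rfl⟩
    exact ⟨y, hp, hq⟩
  · rintro ⟨y, hp, hq⟩
    exact ⟨_, hp, _, hq, y, rfl, rfl⟩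

theorem ext_rel {P Q : Set S.Elem} (h : ∀ x y, S.rel x y ∈ P ↔ S.rel x y ∈ Q) : P = Q := by
  ext s
  obtain ⟨x, y, rfl⟩ := S.exists_rel s
  exact h x y

theorem cmul_assoc (P Q R : Set S.Elem) :
    S.cmul (S.cmul P Q) R = S.cmul P (S.cmul Q R) := by
  refine S.ext_rel fun x y => ?_
  simp only [rel_mem_cmul]
  constructor
  · rintro ⟨b, ⟨a, h1, h2⟩, h3⟩
    exact ⟨a, h1, b, h2, h3⟩
  · rintro ⟨a, h1, b, h2, h3⟩
    exact ⟨b, ⟨a, h1, h2⟩, h3⟩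

theorem one_cmul (P : Set S.Elem) : S.cmul {S.one} P = P := by
  refine S.ext_rel fun x y => ?_
  simp [rel_mem_cmul, rel_eq_one]

theorem cmul_one (P : Set S.Elem) : S.cmul P {S.one} = P := by
  refine S.ext_rel fun x y => ?_
  simp [rel_mem_cmul, rel_eq_one]

/-- The number of intermediate points with prescribed sets of relations to the endpoints of a
pair depends only on the element containing the pair. -/
theorem ncard_between (P Q : Set S.Elem) {x z x' z' : X} (h : S.rel x z = S.rel x' z') :
    {y | S.rel x y ∈ P ∧ S.rel y z ∈ Q}.ncard =
      {y | S.rel x' y ∈ P ∧ S.rel y z' ∈ Q}.ncard := by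
  classical
  have := Fintype.ofFinite X
  have := Fintype.ofFinite S.Elem
  have key : ∀ x z : X, {y | S.rel x y ∈ P ∧ S.rel y z ∈ Q}.ncard =
      ∑ b ∈ P.toFinset ×ˢ Q.toFinset, S.structConst b.1 b.2 (S.rel x z) := by
    intro x z
    rw [Set.ncard_eq_toFinset_card', Finset.card_eq_sum_card_fiberwise
      (f := fun y => (S.rel x y, S.rel y z)) (t := P.toFinset ×ˢ Q.toFinset)]
    · refine Finset.sum_congr rfl fun b hb => ?_
      rw [structConst_rel, Set.ncard_eq_toFinset_card']
      congr 1
      ext y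
      simp only [Finset.mem_product, Set.mem_toFinset] at hb
      simp only [Finset.mem_filter, Set.mem_toFinset, Set.mem_ofPred_eq, Prod.ext_iff]
      constructor
      · exact fun h => h.2
      · rintro ⟨h1, h2⟩
        exact ⟨⟨h1 ▸ hb.1, h2 ▸ hb.2⟩, h1, h2⟩
    · intro y hy
      simpa using hy
  rw [key, key, h]

end Basic

section Closed

variable {X : Type u} [Finite X] {S : AssocScheme X} {T : Set S.Elem}

theorem IsClosedSubset.trans (hT : S.IsClosedSubset T) {x y z : X} (h : S.rel x y ∈ T)
    (h' : S.rel y z ∈ T) : S.rel x z ∈ T :=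
  hT.2 ▸ S.rel_mem_cmul.2 ⟨y, h, h'⟩

theorem coset_eq (x : X) : S.coset T x = {y | S.rel x y ∈ T} := by
  ext y
  constructor
  · rintro ⟨t, ht, h⟩
    have e : S.rel x y = t := S.rel_eq_iff.2 h
    change S.rel x y ∈ T
    rwa [e]
  · intro h
    exact ⟨_, h, S.mem_rel x y⟩

theorem ncard_coset (x y : X) : (S.coset T x).ncard = (S.coset T y).ncard := by
  have := S.ncard_between T Set.univ ((S.rel_self x).trans (S.rel_self y).symm)
  simpa [coset_eq] using this

theorem IsClosedSubset.coset_eq_of_mem (hT : S.IsClosedSubset T) {x y : X}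
    (h : S.rel x y ∈ T) : S.coset T y = S.coset T x := by
  refine Set.eq_of_subset_of_ncard_le ?_ (ncard_coset x y).le (Set.toFinite _)
  rw [coset_eq, coset_eq]
  exact fun z hz => hT.trans h hz

theorem IsClosedSubset.one_mem (hT : S.IsClosedSubset T) : S.one ∈ T := by
  obtain ⟨t, ht⟩ := hT.1
  obtain ⟨x, y, rfl⟩ := S.exists_rel t
  have h : y ∈ S.coset T y := by
    rw [hT.coset_eq_of_mem ht, coset_eq]
    exact ht
  rw [coset_eq] at h
  exact S.rel_self y ▸ h

theorem IsClosedSubset.refl (hT : S.IsClosedSubset T) (x : X) : S.rel x x ∈ T :=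
  (S.rel_self x).symm ▸ hT.one_mem

theorem IsClosedSubset.symm (hT : S.IsClosedSubset T) {x y : X} (h : S.rel x y ∈ T) :
    S.rel y x ∈ T := by
  have h' : x ∈ S.coset T y := by
    rw [hT.coset_eq_of_mem h, coset_eq]
    exact hT.refl x
  rwa [coset_eq] at h'

theorem isClosedSubset_of (h1 : S.one ∈ T)
    (h2 : ∀ x y z, S.rel x y ∈ T → S.rel y z ∈ T → S.rel x z ∈ T) : S.IsClosedSubset T := by
  refine ⟨⟨_, h1⟩, S.ext_rel fun x z => ?_⟩
  rw [rel_mem_cmul]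
  constructor
  · rintro ⟨y, h, h'⟩
    exact h2 x y z h h'
  · intro h
    exact ⟨z, h, by rwa [rel_self]⟩

theorem IsClosedSubset.toCoset_eq (hT : S.IsClosedSubset T) {x y : X} :
    S.toCoset T x = S.toCoset T y ↔ S.rel x y ∈ T := by
  constructor
  · intro h
    have h : S.coset T x = S.coset T y := congrArg Subtype.val h
    have h' : y ∈ S.coset T x := by
      rw [h, coset_eq]
      exact hT.refl y
    rwa [coset_eq] at h'
  · intro h
    exact Subtype.ext (hT.coset_eq_of_mem h).symm

theorem toCoset_surjective : Function.Surjective (S.toCoset T) := by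
  rintro ⟨_, x, rfl⟩
  exact ⟨x, rfl⟩

theorem mem_quotRel {s : S.Elem} {x y : X} :
    (S.toCoset T x, S.toCoset T y) ∈ S.quotRel T s ↔
      ∃ x' y', S.rel x x' ∈ T ∧ S.rel y y' ∈ T ∧ S.rel x' y' = s := by
  simp only [quotRel, toCoset, Set.mem_ofPred_eq, coset_eq, rel_eq_iff]
  constructor
  · rintro ⟨x', h1, y', h2, h⟩
    exact ⟨x', y', h1, h2, h⟩
  · rintro ⟨x', y', h1, h2, h⟩
    exact ⟨x', h1, y', h2, h⟩

theorem IsClosedSubset.mem_quotRel_iff_cmul (hT : S.IsClosedSubset T) {s : S.Elem} {x y : X} :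
    (S.toCoset T x, S.toCoset T y) ∈ S.quotRel T s ↔
      S.rel x y ∈ S.cmul (S.cmul T {s}) T := by
  simp only [mem_quotRel, rel_mem_cmul, Set.mem_singleton_iff]
  constructor
  · rintro ⟨x', y', h1, h2, h⟩
    exact ⟨y', ⟨x', h1, h⟩, hT.symm h2⟩
  · rintro ⟨y', ⟨x', h1, h⟩, h2⟩
    exact ⟨x', y', h1, hT.symm h2, h⟩

theorem IsClosedSubset.mem_quotRel_rel (hT : S.IsClosedSubset T) (x y : X) :
    (S.toCoset T x, S.toCoset T y) ∈ S.quotRel T (S.rel x y) :=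
  mem_quotRel.2 ⟨x, y, hT.refl x, hT.refl y, rfl⟩

theorem IsClosedSubset.quotRel_subset (hT : S.IsClosedSubset T) {s q : S.Elem} {x y : X}
    (hs : (S.toCoset T x, S.toCoset T y) ∈ S.quotRel T s)
    (hq : (S.toCoset T x, S.toCoset T y) ∈ S.quotRel T q) :
    S.quotRel T s ⊆ S.quotRel T q := by
  rintro ⟨c, d⟩ h
  obtain ⟨a, rfl⟩ := toCoset_surjective c
  obtain ⟨b, rfl⟩ := toCoset_surjective d
  obtain ⟨x1, y1, hx1, hy1, rfl⟩ := mem_quotRel.1 hs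
  obtain ⟨a1, b1, ha1, hb1, hab⟩ := mem_quotRel.1 h
  have e1 : S.toCoset T x = S.toCoset T x1 := hT.toCoset_eq.2 hx1
  have e2 : S.toCoset T y = S.toCoset T y1 := hT.toCoset_eq.2 hy1
  have e3 : S.toCoset T a = S.toCoset T a1 := hT.toCoset_eq.2 ha1
  have e4 : S.toCoset T b = S.toCoset T b1 := hT.toCoset_eq.2 hb1
  rw [e1, e2, hT.mem_quotRel_iff_cmul] at hq
  rw [e3, e4, hT.mem_quotRel_iff_cmul, hab]
  exact hq

theorem IsClosedSubset.quotRel_eq (hT : S.IsClosedSubset T) {s q : S.Elem} {x y : X}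
    (hs : (S.toCoset T x, S.toCoset T y) ∈ S.quotRel T s)
    (hq : (S.toCoset T x, S.toCoset T y) ∈ S.quotRel T q) :
    S.quotRel T s = S.quotRel T q :=
  (hT.quotRel_subset hs hq).antisymm (hT.quotRel_subset hq hs)

theorem IsClosedSubset.ncard_preimage (hT : S.IsClosedSubset T) (C : Set (S.Cosets T)) (x : X) :
    (S.toCoset T ⁻¹' C).ncard = C.ncard * (S.coset T x).ncard := by
  classical
  have := Fintype.ofFinite X
  have := Fintype.ofFinite (S.Cosets T)
  rw [Set.ncard_eq_toFinset_card', Set.ncard_eq_toFinset_card' C,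
    Finset.card_eq_sum_card_fiberwise (f := S.toCoset T) (t := C.toFinset)]
  · refine Finset.sum_const_nat fun c hc => ?_
    obtain ⟨z, rfl⟩ := toCoset_surjective c
    rw [ncard_coset x z, Set.ncard_eq_toFinset_card']
    congr 1
    ext y
    simp only [Set.mem_toFinset] at hc
    simp only [Finset.mem_filter, Set.mem_toFinset, Set.mem_preimage, coset_eq,
      Set.mem_ofPred_eq]
    constructor
    · exact fun h => hT.toCoset_eq.1 h.2.symm
    · intro h
      have h := hT.toCoset_eq.2 h
      exact ⟨h ▸ hc, h.symm⟩
  · intro y hy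
    simpa using hy

/-- The quotient scheme `S // T` on `X/T`, for a closed subset `T`. -/
def quotient (S : AssocScheme X) (T : Set S.Elem) (hT : S.IsClosedSubset T) :
    AssocScheme (S.Cosets T) where
  rels := Set.range (S.quotRel T)
  isPartition := by
    constructor
    · rintro ⟨s, hs⟩
      obtain ⟨x, y, rfl⟩ := S.exists_rel s
      exact Set.notMem_empty _ (hs ▸ hT.mem_quotRel_rel x y)
    · rintro ⟨c, d⟩
      obtain ⟨x, rfl⟩ := toCoset_surjective c
      obtain ⟨y, rfl⟩ := toCoset_surjective d
      refine ⟨_, ⟨⟨S.rel x y, rfl⟩, hT.mem_quotRel_rel x y⟩, ?_⟩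
      rintro _ ⟨⟨s, rfl⟩, hs⟩
      exact hT.quotRel_eq hs (hT.mem_quotRel_rel x y)
  diag_mem := by
    refine ⟨S.one, ?_⟩
    ext ⟨c, d⟩
    obtain ⟨x, rfl⟩ := toCoset_surjective c
    obtain ⟨y, rfl⟩ := toCoset_surjective d
    rw [mem_quotRel, Set.mem_ofPred_eq, hT.toCoset_eq]
    constructor
    · rintro ⟨x', y', h1, h2, h⟩
      obtain rfl := S.rel_eq_one.1 h
      exact hT.trans h1 (hT.symm h2)
    · intro h
      exact ⟨y, y, h, hT.refl y, S.rel_self y⟩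
  transpose_mem := by
    rintro _ ⟨s, rfl⟩
    refine ⟨S.inv s, ?_⟩
    ext ⟨c, d⟩
    constructor
    · rintro ⟨x', h1, y', h2, h⟩
      exact ⟨y', h2, x', h1, h⟩
    · rintro ⟨x', h1, y', h2, h⟩
      exact ⟨y', h2, x', h1, h⟩
  regular := by
    rintro _ ⟨p, rfl⟩ _ ⟨q, rfl⟩ _ ⟨r, rfl⟩
    obtain ⟨x₀, z₀, rfl⟩ := S.exists_rel r
    refine ⟨{y : S.Cosets T | (S.toCoset T x₀, y) ∈ S.quotRel T p ∧
      (y, S.toCoset T z₀) ∈ S.quotRel T q}.ncard, fun c d h => ?_⟩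
    obtain ⟨x, rfl⟩ := toCoset_surjective c
    obtain ⟨z, rfl⟩ := toCoset_surjective d
    obtain ⟨x1, z1, hx, hz, hr⟩ := mem_quotRel.1 h
    rw [hT.toCoset_eq.2 hx, hT.toCoset_eq.2 hz]
    have hpos : 0 < (S.coset T x₀).ncard := by
      rw [Set.ncard_pos (Set.toFinite _), coset_eq]
      exact ⟨x₀, hT.refl x₀⟩
    refine Nat.eq_of_mul_eq_mul_right hpos ?_
    rw [← hT.ncard_preimage, ← hT.ncard_preimage]
    simp only [Set.preimage_ofPred_eq, hT.mem_quotRel_iff_cmul]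
    exact S.ncard_between _ _ hr

/-- The element `s^T` of `S // T`. -/
def quotElem (hT : S.IsClosedSubset T) (s : S.Elem) : (S.quotient T hT).Elem :=
  ⟨S.quotRel T s, s, rfl⟩

theorem quotElem_surjective (hT : S.IsClosedSubset T) :
    Function.Surjective (quotElem hT) := by
  rintro ⟨_, s, rfl⟩
  exact ⟨s, rfl⟩

theorem quotient_rel (hT : S.IsClosedSubset T) (x y : X) :
    (S.quotient T hT).rel (S.toCoset T x) (S.toCoset T y) = quotElem hT (S.rel x y) :=
  (S.quotient T hT).rel_eq_iff.2 (hT.mem_quotRel_rel x y)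

theorem quotElem_rel_eq_iff (hT : S.IsClosedSubset T) {x y : X} {s : S.Elem} :
    quotElem hT (S.rel x y) = quotElem hT s ↔
      ∃ x' y', S.rel x x' ∈ T ∧ S.rel y y' ∈ T ∧ S.rel x' y' = s := by
  rw [← quotient_rel, rel_eq_iff, ← mem_quotRel]
  rfl

theorem isStronglyNormal_of (hT : S.IsClosedSubset T)
    (h : ∀ x x' y y', S.rel x y = S.rel x' y' → S.rel x x' ∈ T → S.rel y y' ∈ T) :
    S.IsStronglyNormal T := by
  have hsub : ∀ p : S.Elem, S.cmul (S.cmul {S.inv p} T) {p} ⊆ T := by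
    intro p s hs
    obtain ⟨y, y', rfl⟩ := S.exists_rel s
    obtain ⟨x', h0, h3⟩ := S.rel_mem_cmul.1 hs
    obtain ⟨x, h1, h2⟩ := S.rel_mem_cmul.1 h0
    rw [Set.mem_singleton_iff] at h1 h3
    have h1' : S.rel x y = p := by rw [S.rel_swap y x, h1, inv_inv]
    exact h x x' y y' (h1'.trans h3.symm) h2
  refine ⟨hT, fun p => (hsub p).antisymm fun s hs => ?_⟩
  obtain ⟨y, y', rfl⟩ := S.exists_rel s
  obtain ⟨a, b, rfl⟩ := S.exists_rel p
  -- `y` and `y'` both have preimages under the relation, since all valencies are positive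
  have hex : ∀ y : X, ∃ x, S.rel x y = S.rel a b := by
    intro y
    have h1 : S.rel y y ∈ S.cmul {S.inv (S.rel a b)} {S.rel a b} := by
      rw [rel_self, ← S.rel_self b, rel_mem_cmul]
      exact ⟨a, by rw [Set.mem_singleton_iff, S.rel_swap a b], rfl⟩
    obtain ⟨x, _, h2⟩ := S.rel_mem_cmul.1 h1
    exact ⟨x, h2⟩
  obtain ⟨x, hx⟩ := hex y
  obtain ⟨x', hx'⟩ := hex y'
  refine S.rel_mem_cmul.2 ⟨x', S.rel_mem_cmul.2 ⟨x, ?_, ?_⟩, hx'⟩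
  · rw [Set.mem_singleton_iff, S.rel_swap x y, hx]
  · have hsw : S.rel y x = S.rel y' x' := by
      rw [S.rel_swap x y, S.rel_swap x' y', hx, hx']
    exact h y y' x x' hsw hs

theorem IsStronglyNormal.transport (hT : S.IsStronglyNormal T) {x x' y y' : X}
    (h : S.rel x y = S.rel x' y') (hx : S.rel x x' ∈ T) : S.rel y y' ∈ T := by
  rw [← hT.2 (S.rel x y)]
  refine S.rel_mem_cmul.2 ⟨x', S.rel_mem_cmul.2 ⟨x, ?_, hx⟩, h.symm⟩
  rw [Set.mem_singleton_iff, S.rel_swap x y]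

/-- The quotient by a strongly normal closed subset is thin. -/
theorem IsStronglyNormal.quotient_isThin (hT : S.IsStronglyNormal T) :
    (S.quotient T hT.1).IsThin := by
  intro s
  obtain ⟨s, rfl⟩ := quotElem_surjective hT.1 s
  refine ext_rel _ fun c d => ?_
  obtain ⟨x, rfl⟩ := toCoset_surjective c
  obtain ⟨z, rfl⟩ := toCoset_surjective d
  rw [rel_mem_cmul, Set.mem_singleton_iff, rel_eq_one]
  simp only [Set.mem_singleton_iff]
  constructor
  · rintro ⟨w, h1, h2⟩
    obtain ⟨y, rfl⟩ := toCoset_surjective w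
    rw [rel_swap, (Function.LeftInverse.injective (inv_inv _)).eq_iff, quotient_rel,
      quotElem_rel_eq_iff] at h2
    rw [quotient_rel, quotElem_rel_eq_iff] at h1
    obtain ⟨x1, y1, hx1, hy1, rfl⟩ := h1
    obtain ⟨z2, y2, hz2, hy2, h2⟩ := h2
    have hyy : S.rel y1 y2 ∈ T := hT.1.trans (hT.1.symm hy1) hy2
    have : S.rel x1 z2 ∈ T := by
      refine hT.transport ?_ hyy
      rw [S.rel_swap x1 y1, S.rel_swap z2 y2, h2]
    rw [hT.1.toCoset_eq]
    exact hT.1.trans hx1 (hT.1.trans this (hT.1.symm hz2))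
  · intro h
    rw [← h]
    obtain ⟨a, b, rfl⟩ := S.exists_rel s
    have hex : S.rel x x ∈ S.cmul {S.rel a b} {S.inv (S.rel a b)} := by
      rw [rel_self, ← S.rel_self a, rel_mem_cmul]
      exact ⟨b, rfl, by rw [Set.mem_singleton_iff, S.rel_swap a b]⟩
    obtain ⟨y, h1, _⟩ := S.rel_mem_cmul.1 hex
    rw [Set.mem_singleton_iff] at h1
    refine ⟨S.toCoset T y, ?_, ?_⟩
    · rw [quotient_rel, h1]
    · rw [rel_swap, quotient_rel, h1]

theorem isStronglyNormal_thinResidue (S : AssocScheme X) :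
    S.IsStronglyNormal S.thinResidue := by
  refine isStronglyNormal_of (isClosedSubset_of ?_ ?_) ?_
  · exact fun T hT => hT.1.one_mem
  · exact fun x y z h1 h2 T hT => hT.1.trans (h1 T hT) (h2 T hT)
  · exact fun x x' y y' h hx T hT => hT.transport h (hx T hT)

end Closed

section Thin

variable {X : Type u} [Finite X] {S : AssocScheme X}

theorem IsThin.eq_right (h : S.IsThin) {x x' y : X} (e : S.rel x y = S.rel x' y) : x = x' := by
  have : S.rel x x' ∈ S.cmul {S.rel x y} {S.inv (S.rel x y)} :=
    S.rel_mem_cmul.2 ⟨y, rfl, by rw [Set.mem_singleton_iff, S.rel_swap x' y, e]⟩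
  rw [h, Set.mem_singleton_iff] at this
  exact S.rel_eq_one.1 this

theorem IsThin.eq_left (h : S.IsThin) {x y y' : X} (e : S.rel x y = S.rel x y') : y = y' := by
  refine h.eq_right (y := x) ?_
  rw [S.rel_swap x y, S.rel_swap x y', e]

theorem IsThin.cmul_rel (h : S.IsThin) (x y z : X) :
    S.cmul {S.rel x y} {S.rel y z} = {S.rel x z} := by
  ext r
  constructor
  · rintro ⟨p, rfl, q, rfl, hr⟩
    rw [Set.mem_singleton_iff]
    obtain ⟨a, c, rfl⟩ := S.exists_rel r
    rw [structConst_rel, Set.ncard_pos (Set.toFinite _)] at hr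
    obtain ⟨b, h1, h2⟩ := hr
    have hx : S.rel x z ∈ S.cmul {S.rel a b} {S.rel b c} :=
      S.rel_mem_cmul.2 ⟨y, h1.symm, h2.symm⟩
    -- transfer the triangle `(x, y, z)` to one with the same endpoints as `(a, c)`
    have hpos : ∃ z', S.rel a z' = S.rel x z := by
      have : S.rel a a ∈ S.cmul {S.rel x z} {S.inv (S.rel x z)} := by
        rw [h, rel_self]; rfl
      obtain ⟨z', hz', _⟩ := S.rel_mem_cmul.1 this
      exact ⟨z', hz'⟩
    obtain ⟨z', hz'⟩ := hpos
    rw [← hz'] at hx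
    obtain ⟨b', e1, e2⟩ := S.rel_mem_cmul.1 hx
    rw [Set.mem_singleton_iff] at e1 e2
    obtain rfl := h.eq_left e1
    obtain rfl := h.eq_left e2
    exact hz'
  · rintro rfl
    exact S.rel_mem_cmul.2 ⟨y, rfl, rfl⟩

theorem IsThin.exists_triangle (h : S.IsThin) (p q : S.Elem) :
    ∃ x y z, S.rel x y = p ∧ S.rel y z = q := by
  obtain ⟨x, y, rfl⟩ := S.exists_rel p
  have : S.rel y y ∈ S.cmul {q} {S.inv q} := by
    rw [h, rel_self]; rfl
  obtain ⟨z, hz, _⟩ := S.rel_mem_cmul.1 this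
  exact ⟨x, y, z, rfl, hz⟩

/-- The singleton subsets of the set of elements of a thin scheme. -/
def ThinGroup (S : AssocScheme X) (_h : S.IsThin) : Type u :=
  {P : Set S.Elem // ∃ s, P = {s}}

/-- The singleton subsets of a thin scheme form a group under the complex product. -/
instance ThinGroup.instGroup (h : S.IsThin) : Group (ThinGroup S h) where
  mul P Q := ⟨S.cmul P.1 Q.1, by
    obtain ⟨_, p, rfl⟩ := P
    obtain ⟨_, q, rfl⟩ := Q
    obtain ⟨x, y, z, rfl, rfl⟩ := h.exists_triangle p q
    exact ⟨_, h.cmul_rel x y z⟩⟩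
  one := ⟨{S.one}, _, rfl⟩
  inv P := ⟨{s | S.inv s ∈ P.1}, by
    obtain ⟨_, p, rfl⟩ := P
    refine ⟨S.inv p, Set.ext fun s => ?_⟩
    simp only [Set.mem_ofPred_eq, Set.mem_singleton_iff]
    exact ⟨fun h => by rw [← h, inv_inv], fun h => by rw [h, inv_inv]⟩⟩
  mul_assoc P Q R := Subtype.ext (S.cmul_assoc P.1 Q.1 R.1)
  one_mul P := Subtype.ext (S.one_cmul P.1)
  mul_one P := Subtype.ext (S.cmul_one P.1)
  inv_mul_cancel := by
    rintro ⟨_, p, rfl⟩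
    refine Subtype.ext ?_
    have e : {s | S.inv s ∈ ({p} : Set S.Elem)} = {S.inv p} := by
      ext s
      simp only [Set.mem_ofPred_eq, Set.mem_singleton_iff]
      exact ⟨fun h => by rw [← h, inv_inv], fun h => by rw [h, inv_inv]⟩
    change S.cmul {s | S.inv s ∈ ({p} : Set S.Elem)} {p} = {S.one}
    rw [e]
    exact h (S.inv p)

instance ThinGroup.instFinite (h : S.IsThin) : Finite (ThinGroup S h) :=
  inferInstanceAs (Finite {P : Set S.Elem // ∃ s, P = {s}})

/-- The singleton `{s}` as an element of the group. -/
def ThinGroup.single (h : S.IsThin) (s : S.Elem) : ThinGroup S h := ⟨{s}, s, rfl⟩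

end Thin

section GroupScheme

/-- The relation `g~ = {(g₁, g₂) : g₂ = g₁ g}` on a group. -/
def groupRel {G : Type u} [Group G] (g : G) : Set (G × G) := {w | w.2 = w.1 * g}

/-- The scheme `S(G)` of a finite group `G`. -/
def ofGroup (G : Type u) [Group G] [Finite G] : AssocScheme G where
  rels := Set.range groupRel
  isPartition := by
    constructor
    · rintro ⟨g, hg⟩
      have : ((1 : G), g) ∈ groupRel g := by simp [groupRel]
      exact Set.notMem_empty _ (hg ▸ this)
    · rintro ⟨a, b⟩
      refine ⟨groupRel (a⁻¹ * b), ⟨⟨_, rfl⟩, by simp [groupRel]⟩, ?_⟩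
      rintro _ ⟨⟨g, rfl⟩, h⟩
      have h : b = a * g := h
      rw [h, inv_mul_cancel_left]
  diag_mem := ⟨1, by ext ⟨a, b⟩; simp [groupRel, eq_comm]⟩
  transpose_mem := by
    rintro _ ⟨g, rfl⟩
    refine ⟨g⁻¹, ?_⟩
    ext ⟨a, b⟩
    simp only [groupRel, Set.mem_ofPred_eq]
    exact eq_mul_inv_iff_mul_eq.trans eq_comm
  regular := by
    classical
    rintro _ ⟨g, rfl⟩ _ ⟨h, rfl⟩ _ ⟨k, rfl⟩
    refine ⟨if g * h = k then 1 else 0, fun x z hxz => ?_⟩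
    have hxz : z = x * k := hxz
    subst hxz
    have e : {y : G | (x, y) ∈ groupRel g ∧ (y, x * k) ∈ groupRel h} =
        if g * h = k then {x * g} else ∅ := by
      ext y
      simp only [groupRel, Set.mem_ofPred_eq]
      split_ifs with hk
      · subst hk
        simp only [Set.mem_singleton_iff]
        constructor
        · exact fun h => h.1
        · rintro rfl
          exact ⟨rfl, (mul_assoc _ _ _).symm⟩
      · simp only [Set.mem_empty_iff_false, iff_false]
        rintro ⟨rfl, h2⟩
        rw [mul_assoc] at h2
        exact hk (mul_left_cancel h2).symm
    rw [e]
    split_ifs <;> simp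

/-- The element `g~` of `S(G)`. -/
def tilde {G : Type u} [Group G] [Finite G] (g : G) : (ofGroup G).Elem := ⟨groupRel g, g, rfl⟩

theorem tilde_bijective {G : Type u} [Group G] [Finite G] :
    Function.Bijective (tilde : G → (ofGroup G).Elem) := by
  constructor
  · intro g h e
    have h1 : ((1 : G), g) ∈ groupRel g := by simp [groupRel]
    have e : groupRel g = groupRel h := congrArg Subtype.val e
    rw [e] at h1
    simpa [groupRel] using h1
  · rintro ⟨_, g, rfl⟩
    exact ⟨g, rfl⟩

/-- The element `g` such that `g~ = s`. -/
noncomputable def untilde {G : Type u} [Group G] [Finite G] : (ofGroup G).Elem → G :=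
  (Equiv.ofBijective tilde tilde_bijective).symm

@[simp]
theorem untilde_tilde {G : Type u} [Group G] [Finite G] (g : G) : untilde (tilde g) = g :=
  (Equiv.ofBijective tilde tilde_bijective).symm_apply_apply g

theorem mem_tilde {G : Type u} [Group G] [Finite G] {g a b : G} :
    (a, b) ∈ (tilde g).1 ↔ b = a * g := Iff.rfl

end GroupScheme

/-- A morphism of schemes: a map on points and a map on elements which are compatible. -/
@[ext]
structure Mor {X Y : Type u} [Finite X] [Finite Y] (S : AssocScheme X) (T : AssocScheme Y) where
  /-- the map on points -/
  pt : X → Y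
  /-- the map on elements -/
  el : S.Elem → T.Elem
  map_mem : ∀ (s : S.Elem) (x₁ x₂ : X), (x₁, x₂) ∈ s.1 → (pt x₁, pt x₂) ∈ (el s).1

namespace Mor

variable {X Y Z : Type u} [Finite X] [Finite Y] [Finite Z]
  {S : AssocScheme X} {T : AssocScheme Y} {U : AssocScheme Z}

/-- Admissible morphisms. -/
def IsAdmissible (φ : Mor S T) : Prop :=
  ∀ (x : X) (y : Y) (s : S.Elem), (φ.pt x, y) ∈ (φ.el s).1 →
    ∃ x' : X, φ.pt x' = y ∧ (x, x') ∈ s.1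

/-- The identity morphism. -/
def id (S : AssocScheme X) : Mor S S := ⟨fun x => x, fun s => s, fun _ _ _ h => h⟩

/-- Composition of morphisms (first `φ`, then `ψ`). -/
def comp (φ : Mor S T) (ψ : Mor T U) : Mor S U :=
  ⟨fun x => ψ.pt (φ.pt x), fun s => ψ.el (φ.el s),
    fun s x₁ x₂ h => ψ.map_mem _ _ _ (φ.map_mem s x₁ x₂ h)⟩

theorem isAdmissible_id (S : AssocScheme X) : (id S).IsAdmissible :=
  fun _ y _ h => ⟨y, rfl, h⟩

theorem IsAdmissible.comp {φ : Mor S T} {ψ : Mor T U} (hφ : φ.IsAdmissible)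
    (hψ : ψ.IsAdmissible) : (φ.comp ψ).IsAdmissible := by
  intro x z s h
  obtain ⟨y, hy, h1⟩ := hψ (φ.pt x) z (φ.el s) h
  obtain ⟨x', hx, h2⟩ := hφ x y s h1
  exact ⟨x', by simp only [Mor.comp, hx, hy], h2⟩

theorem el_rel (φ : Mor S T) (x y : X) : φ.el (S.rel x y) = T.rel (φ.pt x) (φ.pt y) :=
  (T.rel_eq_iff.2 (φ.map_mem _ x y (S.mem_rel x y))).symm

/-- A morphism maps the thin residue into the thin residue. -/
theorem el_mem_thinResidue (φ : Mor S T) {s : S.Elem} (hs : s ∈ S.thinResidue) :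
    φ.el s ∈ T.thinResidue := by
  have hT := T.isStronglyNormal_thinResidue
  refine hs {s | φ.el s ∈ T.thinResidue} (isStronglyNormal_of (isClosedSubset_of ?_ ?_) ?_)
  · obtain ⟨x, y, rfl⟩ := S.exists_rel s
    rw [Set.mem_ofPred_eq, ← S.rel_self x, el_rel]
    exact hT.1.refl _
  · intro x y z h1 h2
    rw [Set.mem_ofPred_eq, el_rel] at *
    exact hT.1.trans h1 h2
  · intro x x' y y' h hx
    rw [Set.mem_ofPred_eq, el_rel] at *
    refine hT.transport ?_ hx
    rw [← el_rel, ← el_rel, h]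

end Mor

section Quo

variable {X Y Z : Type u} [Finite X] [Finite Y] [Finite Z]
  {S : AssocScheme X} {T : AssocScheme Y} {U : AssocScheme Z}

/-- The thin quotient `S // O^θ(S)`. -/
def thinQuotient (S : AssocScheme X) : AssocScheme (S.Cosets S.thinResidue) :=
  S.quotient S.thinResidue S.isStronglyNormal_thinResidue.1

theorem thinQuotient_isThin (S : AssocScheme X) : S.thinQuotient.IsThin :=
  S.isStronglyNormal_thinResidue.quotient_isThin

/-- The element `s^{O^θ(S)}` of the thin quotient. -/
def toThinQuotient (s : S.Elem) : S.thinQuotient.Elem :=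
  quotElem S.isStronglyNormal_thinResidue.1 s

/-- The group `Quo(S)` of singleton subsets of the thin quotient under complex product. -/
abbrev Quo (S : AssocScheme X) : Type u := ThinGroup S.thinQuotient S.thinQuotient_isThin

/-- The element `{s^{O^θ(S)}}` of `Quo(S)`. -/
def Quo.mk (s : S.Elem) : S.Quo := ThinGroup.single _ (toThinQuotient s)

theorem Quo.mk_surjective : Function.Surjective (Quo.mk : S.Elem → S.Quo) := by
  rintro ⟨_, e, rfl⟩
  obtain ⟨s, rfl⟩ := quotElem_surjective _ e
  exact ⟨s, rfl⟩

theorem Quo.mk_eq_iff {s t : S.Elem} :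
    (Quo.mk s : S.Quo) = Quo.mk t ↔ toThinQuotient s = toThinQuotient t := by
  constructor
  · intro h
    exact Set.singleton_injective (congrArg Subtype.val h)
  · exact fun h => congrArg (ThinGroup.single S.thinQuotient_isThin) h

theorem Quo.mk_mul_mk (x y z : X) :
    (Quo.mk (S.rel x y) * Quo.mk (S.rel y z) : S.Quo) = Quo.mk (S.rel x z) := by
  refine Subtype.ext ?_
  have h := S.thinQuotient_isThin.cmul_rel (S.toCoset _ x) (S.toCoset _ y) (S.toCoset _ z)
  have e : ∀ a b, S.thinQuotient.rel (S.toCoset _ a) (S.toCoset _ b) =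
      toThinQuotient (S.rel a b) := fun a b => quotient_rel _ a b
  rw [e, e, e] at h
  exact h

theorem Quo.exists_triangle (P Q : S.Quo) :
    ∃ x y z, P = Quo.mk (S.rel x y) ∧ Q = Quo.mk (S.rel y z) := by
  obtain ⟨p, rfl⟩ := Quo.mk_surjective P
  obtain ⟨q, rfl⟩ := Quo.mk_surjective Q
  obtain ⟨x, y, rfl⟩ := S.exists_rel p
  obtain ⟨a, b, rfl⟩ := S.exists_rel q
  have h : S.rel y y ∈ S.cmul {S.rel a b} {S.inv (S.rel a b)} := by
    rw [rel_self, ← S.rel_self a, rel_mem_cmul]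
    exact ⟨b, rfl, by rw [Set.mem_singleton_iff, S.rel_swap a b]⟩
  obtain ⟨z, hz, _⟩ := S.rel_mem_cmul.1 h
  rw [Set.mem_singleton_iff] at hz
  exact ⟨x, y, z, rfl, by rw [hz]⟩

theorem Mor.toThinQuotient_el (φ : Mor S T) {p q : S.Elem}
    (h : toThinQuotient p = toThinQuotient q) :
    toThinQuotient (φ.el p) = toThinQuotient (φ.el q) := by
  obtain ⟨x, y, rfl⟩ := S.exists_rel p
  obtain ⟨x', y', hx, hy, rfl⟩ := (quotElem_rel_eq_iff _).1 h
  have hx := φ.el_mem_thinResidue hx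
  have hy := φ.el_mem_thinResidue hy
  rw [Mor.el_rel] at hx hy
  rw [Mor.el_rel]
  exact (quotElem_rel_eq_iff _).2 ⟨_, _, hx, hy, (φ.el_rel x' y').symm⟩

/-- The image under `φ` of a set of elements of `S // O^θ(S)`, namely
`{φ(s)^{O^θ(T)} : s^{O^θ(S)} ∈ P}`. -/
def quoImage (φ : Mor S T) (P : Set S.thinQuotient.Elem) : Set T.thinQuotient.Elem :=
  {e | ∃ s : S.Elem, toThinQuotient s ∈ P ∧ e = toThinQuotient (φ.el s)}

theorem quoImage_singleton (φ : Mor S T) (s : S.Elem) :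
    quoImage φ {toThinQuotient s} = {toThinQuotient (φ.el s)} := by
  ext e
  constructor
  · rintro ⟨s', h, rfl⟩
    exact φ.toThinQuotient_el h
  · rintro rfl
    exact ⟨s, rfl, rfl⟩

/-- `Quo(φ)` on underlying sets. -/
def quoFun (φ : Mor S T) (P : S.Quo) : T.Quo :=
  ⟨quoImage φ P.1, by
    obtain ⟨s, rfl⟩ := Quo.mk_surjective P
    exact ⟨_, quoImage_singleton φ s⟩⟩

/-- The defining formula `Quo(φ)({s^{O^θ(S)}}) = {φ(s)^{O^θ(T)}}`. -/
theorem quoFun_mk (φ : Mor S T) (s : S.Elem) :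
    quoFun φ (Quo.mk s) = Quo.mk (φ.el s) :=
  Subtype.ext (quoImage_singleton φ s)

/-- The group homomorphism `Quo(φ)`. -/
def quoHom (φ : Mor S T) : S.Quo →* T.Quo :=
  MonoidHom.mk' (quoFun φ) (by
    intro P Q
    obtain ⟨x, y, z, rfl, rfl⟩ := Quo.exists_triangle P Q
    rw [Quo.mk_mul_mk, quoFun_mk, quoFun_mk, quoFun_mk, Mor.el_rel, Mor.el_rel, Mor.el_rel,
      Quo.mk_mul_mk])

theorem quoHom_mk (φ : Mor S T) (s : S.Elem) :
    quoHom φ (Quo.mk s) = Quo.mk (φ.el s) := quoFun_mk φ s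

end Quo

/-- The admissible morphism `S(f)` of a group homomorphism `f`. -/
noncomputable def ofGroupHom {G H : Type u} [Group G] [Finite G] [Group H] [Finite H]
    (f : G →* H) : Mor (ofGroup G) (ofGroup H) where
  pt := f
  el s := tilde (f (untilde s))
  map_mem := by
    intro s a b h
    obtain ⟨g, rfl⟩ := tilde_bijective.2 s
    rw [mem_tilde] at h
    rw [untilde_tilde, mem_tilde, h, map_mul]

theorem ofGroupHom_el_tilde {G H : Type u} [Group G] [Finite G] [Group H] [Finite H]
    (f : G →* H) (g : G) : (ofGroupHom f).el (tilde g) = tilde (f g) := by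
  simp [ofGroupHom]

theorem ofGroupHom_isAdmissible {G H : Type u} [Group G] [Finite G] [Group H] [Finite H]
    (f : G →* H) : (ofGroupHom f).IsAdmissible := by
  intro a b s h
  obtain ⟨g, rfl⟩ := tilde_bijective.2 s
  rw [ofGroupHom_el_tilde, mem_tilde] at h
  refine ⟨a * g, ?_, rfl⟩
  rw [h]
  exact map_mul f a g

end AssocScheme

/-- The objects of the category of finite association schemes. -/
structure SchemeCat where
  /-- the underlying finite set -/
  carrier : Type u
  [finite : Finite carrier]
  /-- the scheme on it -/
  scheme : AssocScheme carrier

namespace SchemeCat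

attribute [instance] SchemeCat.finite

/-- The category `𝒮` of finite association schemes and admissible morphisms. -/
instance instCategory : Category SchemeCat.{u} where
  Hom S T := {φ : AssocScheme.Mor S.scheme T.scheme // φ.IsAdmissible}
  id S := ⟨AssocScheme.Mor.id S.scheme, AssocScheme.Mor.isAdmissible_id S.scheme⟩
  comp φ ψ := ⟨φ.1.comp ψ.1, φ.2.comp ψ.2⟩

/-- Algebraic equivalence: the two morphisms agree on the elements of the scheme. -/
def AlgEquiv : HomRel SchemeCat.{u} := fun _ _ φ ψ => ∀ s, φ.1.el s = ψ.1.el s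

/-- Algebraic equivalence is a congruence, so the quotient category by it has exactly the
algebraic equivalence classes as its morphisms. -/
instance instCongruence : Congruence AlgEquiv.{u} where
  equivalence := ⟨fun _ _ => rfl, fun h s => (h s).symm, fun h h' s => (h s).trans (h' s)⟩
  comp_left f _ _ h := fun s => h (f.1.el s)
  comp_right g h := fun s => congrArg g.1.el (h s)

/-- The functor `S` from finite groups to schemes. -/
noncomputable def ofGroupFunctor : FiniteGrp.{u} ⥤ SchemeCat.{u} where
  obj G := ⟨G, AssocScheme.ofGroup G⟩
  map f := ⟨AssocScheme.ofGroupHom (ConcreteCategory.hom f),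
    AssocScheme.ofGroupHom_isAdmissible _⟩
  map_id G := by
    refine Subtype.ext (AssocScheme.Mor.ext rfl (funext fun s => ?_))
    obtain ⟨g, rfl⟩ := AssocScheme.tilde_bijective.2 s
    exact AssocScheme.ofGroupHom_el_tilde _ g
  map_comp f f' := by
    refine Subtype.ext (AssocScheme.Mor.ext rfl (funext fun s => ?_))
    obtain ⟨g, rfl⟩ := AssocScheme.tilde_bijective.2 s
    refine (AssocScheme.ofGroupHom_el_tilde _ g).trans ?_
    change _ = (AssocScheme.ofGroupHom _).el ((AssocScheme.ofGroupHom _).el (AssocScheme.tilde g))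
    rw [AssocScheme.ofGroupHom_el_tilde, AssocScheme.ofGroupHom_el_tilde]
    rfl

/-- The functor `Quo` on the category `𝒮` of schemes and admissible morphisms. -/
noncomputable def quoFunctor : SchemeCat.{u} ⥤ FiniteGrp.{u} where
  obj S := FiniteGrp.of S.scheme.Quo
  map φ := FiniteGrp.ofHom (AssocScheme.quoHom φ.1)
  map_id S := by
    refine ConcreteCategory.hom_ext _ _ fun P => ?_
    obtain ⟨s, rfl⟩ := AssocScheme.Quo.mk_surjective P
    exact AssocScheme.quoHom_mk _ s
  map_comp φ ψ := by
    refine ConcreteCategory.hom_ext _ _ fun P => ?_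
    obtain ⟨s, rfl⟩ := AssocScheme.Quo.mk_surjective P
    refine (AssocScheme.quoHom_mk _ s).trans ?_
    change _ = AssocScheme.quoHom ψ.1 (AssocScheme.quoHom φ.1 (AssocScheme.Quo.mk s))
    rw [AssocScheme.quoHom_mk, AssocScheme.quoHom_mk]
    rfl

end SchemeCat

/-- The category `𝒮_a` of finite association schemes and algebraic equivalence classes of
admissible morphisms. -/
abbrev AlgSchemeCat : Type (u + 1) := CategoryTheory.Quotient SchemeCat.AlgEquiv.{u}

namespace AlgSchemeCat

/-- The functor `S_a : FiniteGrp ⥤ 𝒮_a`, the composite of `S` and the projection `𝒮 ⥤ 𝒮_a`. -/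
noncomputable def Sa : FiniteGrp.{u} ⥤ AlgSchemeCat.{u} :=
  SchemeCat.ofGroupFunctor ⋙ CategoryTheory.Quotient.functor SchemeCat.AlgEquiv

/-- The functor `Quo : 𝒮_a ⥤ FiniteGrp`. -/
noncomputable def Quo : AlgSchemeCat.{u} ⥤ FiniteGrp.{u} :=
  CategoryTheory.Quotient.lift SchemeCat.AlgEquiv SchemeCat.quoFunctor (by
    intro S T φ ψ h
    refine ConcreteCategory.hom_ext _ _ fun P => ?_
    obtain ⟨s, rfl⟩ := AssocScheme.Quo.mk_surjective P
    refine (AssocScheme.quoHom_mk _ s).trans ?_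
    rw [h s]
    exact (AssocScheme.quoHom_mk _ s).symm)

end AlgSchemeCat

/-! The adjunction rests on a bijection between homomorphisms `Quo(S) → G` and algebraic classes of
admissible morphisms `S → S(G)`.

The scheme of a group is already thin: `{1}` is strongly normal in it, so its thin residue is
trivial (`thinResidue_ofGroup`) and `g ↦ {g~}` identifies `G` with `Quo(S(G))`
(`toQuoOfGroup_bijective`). The inverse of this isomorphism is the counit, so a morphism `φ : S →
S(G)` yields the homomorphism `Quo(φ)` followed by the counit.

Conversely, a homomorphism `f` prescribes the map `s ↦ f[s]~` on elements, where `[s]` is the class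
of `s` in `Quo(S)`. A compatible map on points is obtained by fixing a base point `x₀` and sending
`x` to `f[r(x₀, x)]`, where `r(x, y)` is the element containing `(x, y)`. Compatibility is the
identity `[r(x₀, x)][r(x, y)] = [r(x₀, y)]` in `Quo(S)`, and admissibility follows because every
element of `S` leaves every point (`exists_rel_left`). Another base point changes the point map by a
left translation of `G` and leaves the element map alone. This is why the bijection needs morphisms
to be identified when they agree on elements; after that, both round trips and naturality are checks
on elements. -/

namespace AssocScheme

/-! ### The thin quotient of a group scheme -/

section GroupQuo

variable {G : Type u} [Group G] [Finite G]

theorem rel_ofGroup (a b : G) : (ofGroup G).rel a b = tilde (a⁻¹ * b) :=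
  (ofGroup G).rel_eq_iff.2 (mem_tilde.2 (mul_inv_cancel_left a b).symm)

/-- Every closed subset contains `1`, so it is enough that `{1}` is itself strongly normal. In a
group scheme an element and its first point determine the second point, by left cancellation. -/
theorem thinResidue_ofGroup : (ofGroup G).thinResidue = {(ofGroup G).one} := by
  refine Set.Subset.antisymm (fun s hs => hs _ ?_)
    (Set.singleton_subset_iff.2 (ofGroup G).isStronglyNormal_thinResidue.1.one_mem)
  refine isStronglyNormal_of (isClosedSubset_of rfl ?_) ?_
  · simp only [Set.mem_singleton_iff, rel_eq_one]
    exact fun _ _ _ => Eq.trans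
  · simp only [Set.mem_singleton_iff, rel_eq_one]
    rintro x _ y y' h rfl
    rw [rel_ofGroup, rel_ofGroup] at h
    exact mul_left_cancel (tilde_bijective.1 h)

/-- The homomorphism `G →* Quo(S(G))` sending `g` to the class of `g~`. -/
def toQuoOfGroup (G : Type u) [Group G] [Finite G] : G →* (ofGroup G).Quo :=
  MonoidHom.mk' (fun g => Quo.mk (tilde g)) (by
    intro g h
    -- The path `1, g, gh` has steps `g~` and `h~`, and its endpoints are related by `(gh)~`.
    have := Quo.mk_mul_mk (S := ofGroup G) 1 g (g * h)
    simpa [rel_ofGroup] using this.symm)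

theorem toQuoOfGroup_bijective : Function.Bijective (toQuoOfGroup G) := by
  constructor
  · intro g h e
    have e : toThinQuotient (tilde g) = toThinQuotient (tilde h) := Quo.mk_eq_iff.1 e
    have hg : (ofGroup G).rel 1 g = tilde g := by simp [rel_ofGroup]
    rw [← hg] at e
    -- Equality in the quotient only moves the endpoints of the pair `(1, g)` within their cosets.
    -- The residue is trivial, so they do not move and `g~ = h~`.
    obtain ⟨x, y, hx, hy, hxy⟩ := (quotElem_rel_eq_iff _).1 e
    simp only [thinResidue_ofGroup, Set.mem_singleton_iff, rel_eq_one] at hx hy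
    subst hx hy
    exact tilde_bijective.1 (hg.symm.trans hxy)
  · intro P
    obtain ⟨s, rfl⟩ := Quo.mk_surjective P
    obtain ⟨g, rfl⟩ := tilde_bijective.2 s
    exact ⟨g, rfl⟩

/-- The isomorphism `Quo(S(G)) ≃* G`. -/
noncomputable def quoOfGroupEquiv (G : Type u) [Group G] [Finite G] : (ofGroup G).Quo ≃* G :=
  (MulEquiv.ofBijective (toQuoOfGroup G) toQuoOfGroup_bijective).symm

theorem quoOfGroupEquiv_mk (g : G) : quoOfGroupEquiv G (Quo.mk (tilde g)) = g :=
  (MulEquiv.ofBijective (toQuoOfGroup G) toQuoOfGroup_bijective).symm_apply_apply g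

end GroupQuo

/-! ### Morphisms to a group scheme from homomorphisms on the thin quotient -/

section OfQuoHom

variable {X : Type u} [Finite X] {S : AssocScheme X} {G : Type u} [Group G] [Finite G]

/-- The diagonal is an element, and elements are nonempty relations, so there is no scheme on the
empty set. This supplies the base point for `ofQuoHom`. -/
theorem nonempty (S : AssocScheme X) : Nonempty X :=
  let ⟨x, _⟩ := S.exists_rel S.one
  ⟨x⟩

/-- Valencies are positive: some pair `(a, b)` lies in `s`, so `1 ∈ s s^*` by going from `a` to `b`
and back. By regularity the same detour exists at every point `x`. -/
theorem exists_rel_left (x : X) (s : S.Elem) : ∃ y, S.rel x y = s := by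
  obtain ⟨a, b, rfl⟩ := S.exists_rel s
  have h : S.rel x x ∈ S.cmul {S.rel a b} {S.inv (S.rel a b)} := by
    rw [rel_self, ← S.rel_self a, rel_mem_cmul]
    exact ⟨b, rfl, S.rel_swap a b⟩
  obtain ⟨y, hy, _⟩ := S.rel_mem_cmul.1 h
  exact ⟨y, hy⟩

/-- The morphism `S → S(G)` corresponding to a homomorphism `Quo(S) →* G`. On points it depends
on the choice of a base point, on elements it does not. -/
noncomputable def ofQuoHom (f : S.Quo →* G) : Mor S (ofGroup G) where
  pt x := f (Quo.mk (S.rel S.nonempty.some x))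
  el s := tilde (f (Quo.mk s))
  map_mem := by
    intro s x y h
    obtain rfl := S.rel_eq_iff.2 h
    -- The class of the relation from the base point to `y` factors through `x`.
    rw [mem_tilde, ← map_mul, Quo.mk_mul_mk]

/-- In a group scheme the target `g` is forced by the image of `x` and the element `f[s]~`, so any
`y` with `(x, y) ∈ s` must map to `g`. -/
theorem ofQuoHom_isAdmissible (f : S.Quo →* G) : (ofQuoHom f).IsAdmissible := by
  intro x g s h
  obtain ⟨y, rfl⟩ := exists_rel_left x s
  refine ⟨y, ?_, S.mem_rel x y⟩
  rw [mem_tilde.1 h]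
  simp only [ofQuoHom]
  rw [← map_mul, Quo.mk_mul_mk]

end OfQuoHom

end AssocScheme

/-! ### The hom-set bijection, its naturality and the adjunction -/

namespace AlgSchemeCat

open AssocScheme

/-- The morphism `Quo(S(G)) ⟶ G` in the category of finite groups. -/
noncomputable def counitHom (G : FiniteGrp.{u}) : Quo.obj (Sa.obj G) ⟶ G :=
  FiniteGrp.ofHom (quoOfGroupEquiv G).toMonoidHom

theorem counitHom_mk {G : FiniteGrp.{u}} (g : G) :
    ConcreteCategory.hom (counitHom G) (Quo.mk (tilde g) : (ofGroup G).Quo) = g :=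
  quoOfGroupEquiv_mk g

/-- The class of the morphism of schemes corresponding to a homomorphism `Quo(S) ⟶ G`. -/
noncomputable def transpose {S : AlgSchemeCat.{u}} {G : FiniteGrp.{u}} (f : Quo.obj S ⟶ G) :
    S ⟶ Sa.obj G :=
  (CategoryTheory.Quotient.functor SchemeCat.AlgEquiv).map
    (X := S.as) (Y := SchemeCat.ofGroupFunctor.obj G)
    ⟨ofQuoHom (G := G) (ConcreteCategory.hom f), ofQuoHom_isAdmissible (G := G) _⟩

/-- The bijection `(Quo(S) ⟶ G) ≃ (S ⟶ S_a(G))`. -/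
noncomputable def homEquiv (S : AlgSchemeCat.{u}) (G : FiniteGrp.{u}) :
    (Quo.obj S ⟶ G) ≃ (S ⟶ Sa.obj G) where
  toFun := transpose
  invFun φ := Quo.map φ ≫ counitHom G
  left_inv f := by
    refine ConcreteCategory.hom_ext _ _ fun P => ?_
    obtain ⟨s, rfl⟩ := AssocScheme.Quo.mk_surjective P
    -- `Quo` of the transposed morphism sends `[s]` to the class of `f[s]~`, and the counit returns
    -- `f[s]`.
    refine (congrArg (ConcreteCategory.hom (counitHom G)) (quoHom_mk _ s)).trans ?_
    exact counitHom_mk _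
  right_inv φ := by
    obtain ⟨φ, rfl⟩ := (CategoryTheory.Quotient.functor SchemeCat.AlgEquiv).map_surjective
      (X := S.as) (Y := SchemeCat.ofGroupFunctor.obj G) φ
    -- The point maps may differ by the choice of base point. Equality of classes asks only for
    -- agreement on elements.
    refine CategoryTheory.Quotient.sound _ fun s => ?_
    obtain ⟨g, hg⟩ := (tilde_bijective (G := G)).2 (φ.1.el s)
    rw [← hg]
    refine congrArg tilde ?_
    refine (congrArg (ConcreteCategory.hom (counitHom G)) (quoHom_mk φ.1 s)).trans ?_
    rw [← hg]
    exact counitHom_mk g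

/-- Naturality in the group: on elements both sides are `s ↦ g(f[s])~`. -/
theorem transpose_comp {S : AlgSchemeCat.{u}} {G H : FiniteGrp.{u}} (f : Quo.obj S ⟶ G)
    (g : G ⟶ H) : transpose (f ≫ g) = transpose f ≫ Sa.map g := by
  refine Eq.trans ?_ ((CategoryTheory.Quotient.functor SchemeCat.AlgEquiv).map_comp _ _)
  exact CategoryTheory.Quotient.sound _ fun s =>
    (ofGroupHom_el_tilde (G := G) (H := H) (ConcreteCategory.hom g) _).symm

/-- The adjunction between `Quo` and `S_a`. -/
noncomputable def quoAdjunction : Quo.{u} ⊣ Sa.{u} :=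
  Adjunction.mkOfHomEquiv
    { homEquiv := homEquiv
      -- The inverse bijection is `Quo` followed by the counit, so naturality in the scheme is
      -- functoriality of `Quo`.
      homEquiv_naturality_left_symm := fun f g => by simp [homEquiv]
      homEquiv_naturality_right := fun f g => transpose_comp f g }

end AlgSchemeCat

theorem proposition5p5 : Nonempty (AlgSchemeCat.Quo.{u} ⊣ AlgSchemeCat.Sa.{u}) :=
  ⟨AlgSchemeCat.quoAdjunction⟩
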